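/- Let $\mathbb{F}$ be a field and let $A, B \in \mathbb{F}^{n\times n}$. For $S,T\subseteq[n]=\{1,\dots,n\}$ write $A[S,T]$ for the submatrix of $A$ with rows indexed by $S$ and columns indexed by $T$, write $A[S]=A[S,S]$, and let $\overline{X}=[n]\setminus X$. Say that $A$ *satisfies property $\mathcal{R}$* if (1) all off-diagonal entries of $A$ are nonzero, and (2) for any four distinct indices $i,j,k,\ell\in[n]$ with $\operatorname{rank} A[\{i,j\},\{k,\ell\}]=1$ there is a set $X\subseteq[n]$ with $i,j\in X$, $k,\ell\in\overline{X}$ and $\operatorname{rank} A[X,\overline{X}]=1$. A set $X\subseteq[n]$ is a *cut* of $A$ if $2\le |X|\le n-2$ and both $A[X,\overline{X}]$ and $A[\overline{X},X]$ have rank at most one. The matrices $A$ and $B$ are *principal minor equivalent* if $\det A[S]=\det B[S]$ for all $S\subseteq[n]$. **Theorem.** Suppose that $A$ satisfies property $\mathcal{R}$ and has no cut. Then $A$ and $B$ are principal minor equivalent if and only if $\det A[S]=\det B[S]$ for all $S\subseteq[n]$ with $|S|\le 4$. -/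

import Mathlib

namespace PrincipalMinors

variable {ι F : Type*} [Fintype ι] [DecidableEq ι] [Field F]

/-- `A[S, T]`: the submatrix of `A` with rows indexed by `S` and columns indexed by `T`. -/
def sub (A : Matrix ι ι F) (S T : Finset ι) : Matrix S T F :=
  A.submatrix (fun i : S => (i : ι)) (fun j : T => (j : ι))

/-- All off-diagonal entries are nonzero. -/
def IsDense (A : Matrix ι ι F) : Prop :=
  ∀ i j, i ≠ j → A i j ≠ 0

/-- Whenever `A[{i,j}, {k,l}]` has rank one for four distinct indices, this extends to
a rank-one block `A[X, Xᶜ]` with `i, j ∈ X` and `k, l ∈ Xᶜ`. -/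
def RankOneExtension (A : Matrix ι ι F) : Prop :=
  ∀ i j k l : ι, [i, j, k, l].Nodup → (sub A {i, j} {k, l}).rank = 1 →
    ∃ X : Finset ι, i ∈ X ∧ j ∈ X ∧ k ∈ Xᶜ ∧ l ∈ Xᶜ ∧ (sub A X Xᶜ).rank = 1

def PropertyR (A : Matrix ι ι F) : Prop :=
  IsDense A ∧ RankOneExtension A

/-- `X` is a cut of the `n × n` matrix `A`: `2 ≤ |X| ≤ n - 2` and both off-diagonal blocks
`A[X, Xᶜ]` and `A[Xᶜ, X]` have rank at most one. -/
def IsCut (A : Matrix ι ι F) (X : Finset ι) : Prop :=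
  2 ≤ X.card ∧ X.card + 2 ≤ Fintype.card ι ∧
    (sub A X Xᶜ).rank ≤ 1 ∧ (sub A Xᶜ X).rank ≤ 1

/-- Principal minor equivalence. -/
def PME (A B : Matrix ι ι F) : Prop :=
  ∀ S : Finset ι, (sub A S S).det = (sub B S S).det

/-- Equality of corresponding principal minors of order at most `k`. -/
def PMEUpTo (k : ℕ) (A B : Matrix ι ι F) : Prop :=
  ∀ S : Finset ι, S.card ≤ k → (sub A S S).det = (sub B S S).det

end PrincipalMinors

/-! Minors of order at most three fix the diagonal, the products `A i j * A j i` and, for each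
triple, the unordered pair of its two cyclic products. So on every triple whose cyclic products
differ, `B` follows either `A` or its transpose; this colours those triples. If one colour is
absent, `B` is diagonally similar to `A` or to `Aᵀ` (`PME.of_cyc_eq`).

If both colours occur, they occur on two triples with a common pair (`Coloring.exists_adjacent`),
and the minors of order four then force a split of the quadruple into two pairs, with both blocks of
rank one, that separates the colours (`CycEq.rule`). Property R extends each block by a new index,
but perhaps on different sides; `Dich.split_or` finds a common side, and `Dich.exists_cut` assembles
a cut, contrary to hypothesis. Working in the additive group of units makes the rank-one conditions
linear. -/

namespace PrincipalMinors

/-! ### Linear calculus of splits, and two-coloured triples. -/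

section Coloring

variable {ι G : Type*} [AddCommGroup G]

/-- The additive form of the vanishing of the `2 × 2` minor with rows `i, j` and columns `k, l`. -/
def Cross (a : ι → ι → G) (i j k l : ι) : Prop := a i k + a j l = a i l + a j k

/-- Both off-diagonal blocks for the partition `{i, j} | {k, l}` have rank one. -/
def Split (a : ι → ι → G) (i j k l : ι) : Prop := Cross a i j k l ∧ Cross a k l i j

/-- The additive form of the quotient of the two cyclic products on `i, j, k`. -/
def skew (a : ι → ι → G) (i j k : ι) : G := a i j + a j k + a k i - (a j i + a k j + a i k)

variable {a : ι → ι → G}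

lemma skew_rot (i j k : ι) : skew a j k i = skew a i j k := by unfold skew; abel
lemma skew_swap (i j k : ι) : skew a j i k = - skew a i j k := by unfold skew; abel
lemma skew_cocycle (i j k l : ι) : skew a j k l - skew a i k l + skew a i j l - skew a i j k = 0 := by
  unfold skew; abel
lemma skew_eq_iff (i j k l : ι) : skew a i j k = skew a i j l ↔ skew a i k l = skew a j k l := by
  have := skew_cocycle (a := a) i j k l
  constructor <;> intro h <;> grind

lemma Cross.swap_left {i j k l : ι} (h : Cross a i j k l) : Cross a j i k l := by
  unfold Cross at *; rw [add_comm, ← h, add_comm]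
lemma Cross.swap_right {i j k l : ι} (h : Cross a i j k l) : Cross a i j l k := by
  unfold Cross at *; exact h.symm
lemma Cross.trans_right {i j k l m : ι} (h : Cross a i j k l) (h' : Cross a i j k m) :
    Cross a i j l m := by
  unfold Cross at *; grind
lemma Cross.trans_left {i j k l m : ι} (h : Cross a i j k l) (h' : Cross a i m k l) :
    Cross a j m k l := by
  unfold Cross at *; grind
lemma cross_self_left (i k l : ι) : Cross a i i k l := by unfold Cross; abel
lemma cross_self_right (i j k : ι) : Cross a i j k k := by unfold Cross; abel

lemma Split.swap_left {i j k l : ι} (h : Split a i j k l) : Split a j i k l :=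
  ⟨h.1.swap_left, h.2.swap_right⟩
lemma Split.symm {i j k l : ι} (h : Split a i j k l) : Split a k l i j := ⟨h.2, h.1⟩
lemma Split.swap_right {i j k l : ι} (h : Split a i j k l) : Split a i j l k :=
  ⟨h.1.swap_right, h.2.swap_left⟩
lemma Split.trans_right {i j k l m : ι} (h : Split a i j k l) (h' : Split a i j k m) :
    Split a i j l m := ⟨h.1.trans_right h'.1, h.2.trans_left h'.2⟩
lemma Split.trans_left {i j k l m : ι} (h : Split a i j k l) (h' : Split a i m k l) :
    Split a j m k l := ⟨h.1.trans_left h'.1, h.2.trans_right h'.2⟩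
lemma split_self_left (i k l : ι) : Split a i i k l := ⟨cross_self_left .., cross_self_right ..⟩
lemma split_self_right (i j k : ι) : Split a i j k k := ⟨cross_self_right .., cross_self_left ..⟩

lemma Split.skew_eq {i j k l : ι} (h : Split a i j k l) : skew a i j k = skew a i j l := by
  unfold Split Cross at h; unfold skew; grind
lemma Split.skew_eq' {i j k l : ι} (h : Split a i j k l) : skew a i k l = skew a j k l :=
  (skew_eq_iff ..).1 h.skew_eq
-- The difference of the two `skew` values is the difference of the defects in the two `Cross`
-- equations.
lemma cross_comm_of_skew_eq {i j k l : ι} (h : skew a i j k = skew a i j l) :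
    Cross a i j k l ↔ Cross a k l i j := by
  unfold Cross; unfold skew at h
  constructor <;> intro h' <;> grind
/-- A two-colouring of the triples with nonzero `skew`, compatible with the splits of
quadruples on which both colours occur. -/
structure Coloring (a : ι → ι → G) (S O : ι → ι → ι → Prop) : Prop where
  rotS : ∀ i j k, S i j k ↔ S j k i
  swapS : ∀ i j k, S i j k ↔ S j i k
  rotO : ∀ i j k, O i j k ↔ O j k i
  swapO : ∀ i j k, O i j k ↔ O j i k
  neS : ∀ i j k, S i j k → skew a i j k ≠ 0
  neO : ∀ i j k, O i j k → skew a i j k ≠ 0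
  total : ∀ i j k, skew a i j k ≠ 0 → S i j k ∨ O i j k
  disj : ∀ i j k, S i j k → ¬ O i j k
  rule : ∀ i j k l, S i j k → O i j l →
    (S i k l ∧ O j k l ∧ Split a i k j l) ∨ (S j k l ∧ O i k l ∧ Split a j k i l)

/-- The extension property of rank-one `2 × 2` blocks, restricted to one additional index. -/
def Extends (a : ι → ι → G) : Prop := ∀ i j k l m, i ≠ k → i ≠ l → j ≠ k → j ≠ l →
  Cross a i j k l → Cross a i m k l ∨ Cross a i j k m

/-- Both colours occur on `i, j, k, l`, separated by the split `{i, j} | {k, l}`. -/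
structure Dich (a : ι → ι → G) (S O : ι → ι → ι → Prop) (i j k l : ι) : Prop where
  s₁ : S i j k
  s₂ : S i j l
  o₁ : O i k l
  o₂ : O j k l
  split : Split a i j k l

/-- Five indices in cyclic order such that consecutive triples have the first colour and all
other triples have the second one. -/
structure Pent (a : ι → ι → G) (S O : ι → ι → ι → Prop) (u v w x y : ι) : Prop where
  s₀ : S u v w
  s₁ : S v w x
  s₂ : S w x y
  s₃ : S x y u
  s₄ : S y u v
  o₀ : O u v x
  o₁ : O v w y
  o₂ : O w x u
  o₃ : O x y v
  o₄ : O y u w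
  d₀ : Split a u v w y
  d₁ : Split a v w x u
  d₂ : Split a w x y v
  d₃ : Split a x y u w
  d₄ : Split a y u v x

variable {S O : ι → ι → ι → Prop}

namespace Coloring

/-- Combined with `Dich.symm`, this exchanges the left and right of a dichromatic split. -/
lemma dual (H : Coloring a S O) : Coloring a O S where
  rotS := H.rotO
  swapS := H.swapO
  rotO := H.rotS
  swapO := H.swapS
  neS := H.neO
  neO := H.neS
  total i j k h := (H.total i j k h).symm
  disj i j k h h' := H.disj i j k h' h
  rule i j k l h h' := by
    have sw : ∀ i j k, (S i j k ↔ S i k j) ∧ (O i j k ↔ O i k j) := fun i j k =>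
      ⟨(H.swapS i j k).trans (H.rotS j i k), (H.swapO i j k).trans (H.rotO j i k)⟩
    rcases H.rule i j l k h' h with ⟨h1, h2, h3⟩ | ⟨h1, h2, h3⟩
    · exact .inr ⟨(sw ..).2.2 h2, (sw ..).1.2 h1, h3.symm⟩
    · exact .inl ⟨(sw ..).2.2 h2, (sw ..).1.2 h1, h3.symm⟩

end Coloring

lemma Coloring.permS (H : Coloring a S O) {i j k : ι} (h : S i j k) :
    S i k j ∧ S j i k ∧ S j k i ∧ S k i j ∧ S k j i := by
  have := H.rotS; have := H.swapS; grind

lemma Coloring.permO (H : Coloring a S O) {i j k : ι} (h : O i j k) :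
    O i k j ∧ O j i k ∧ O j k i ∧ O k i j ∧ O k j i := H.dual.permS h

lemma Dich.swap_left (H : Coloring a S O) {i j k l : ι} (h : Dich a S O i j k l) :
    Dich a S O j i k l :=
  ⟨(H.permS h.s₁).2.1, (H.permS h.s₂).2.1, h.o₂, h.o₁, h.split.swap_left⟩

lemma Dich.swap_right (H : Coloring a S O) {i j k l : ι} (h : Dich a S O i j k l) :
    Dich a S O i j l k :=
  ⟨h.s₂, h.s₁, (H.permO h.o₁).1, (H.permO h.o₂).1, h.split.swap_right⟩

lemma Dich.symm (H : Coloring a S O) {i j k l : ι} (h : Dich a S O i j k l) :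
    Dich a O S k l i j :=
  ⟨(H.permO h.o₁).2.2.1, (H.permO h.o₂).2.2.1, (H.permS h.s₁).2.2.2.1, (H.permS h.s₂).2.2.2.1,
    h.split.symm⟩

/-- Seven of the ten triples are coloured by assumption. In each use of `rule` a known colour
excludes one alternative, and the other supplies the missing triples and splits. -/
lemma pent_of_dich (H : Coloring a S O) {i j k l m : ι} (h : Dich a S O i j k l)
    (h₁ : O i j m) (h₂ : S i k m) (h₃ : O i l m) : Pent a S O i j l m k := by
  have rS := H.rotS
  have sS := H.swapS
  have rO := H.rotO
  have sO := H.swapO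
  have dj := H.disj
  have r1 : O j k m ∧ Split a i k j m := by
    have := H.rule i j k m h.s₁ h₁
    grind
  have r2 : S k l m ∧ Split a k m i l := by
    have := H.rule i k m l h₂ h.o₁
    grind
  have r3 : S j l m ∧ Split a j l i m := by
    have := H.rule i j l m h.s₂ h₁
    grind
  have r4 : Split a l m j k := by
    have := H.rule j l m k r3.1 (by have := h.o₂; grind)
    grind
  obtain ⟨s₁, s₂, o₁, o₂, d⟩ := h
  exact ⟨s₂, r3.1, (H.permS r2.1).2.2.1, (H.permS h₂).2.2.2.2, (H.permS s₁).2.2.2.1, h₁,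
    (H.permO o₂).1, (H.permO h₃).2.2.1, (H.permO r1.1).2.2.2.2, (H.permO o₁).2.1,
    d.swap_right, r3.2.swap_right, r4.swap_right, r2.2.swap_left, r1.2.swap_left⟩

lemma Dich.cases_of_right (H : Coloring a S O) {i j k l m : ι} (h : Dich a S O i j k l)
    (h₁ : O i j m) (h₂ : S i k m) : Dich a S O i m k l ∨ Pent a S O i j l m k := by
  rcases H.rule i k m l h₂ h.o₁ with ⟨r1, r2, r3⟩ | ⟨r1, r2, r3⟩
  · exact .inl ⟨(H.permS h₂).1, r1, h.o₁, (H.permO r2).2.1, r3⟩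
  · exact .inr (pent_of_dich H h h₁ h₂ (H.permO r2).1)

/-- How an index lying on the left of a dichromatic split can be attached to it. -/
lemma Dich.cases (H : Coloring a S O) {i j k l m : ι} (h : Dich a S O i j k l)
    (hm : ¬ Split a i j k m) :
    (skew a i k m = 0 ∧ skew a j k m = 0 ∧ skew a i l m = 0 ∧ skew a j l m = 0) ∨
      Dich a S O i m k l ∨ Dich a S O j m k l ∨ Pent a S O i j l m k ∨ Pent a S O j i l m k := by
  have rS := H.rotS
  have sS := H.swapS
  have rO := H.rotO
  have sO := H.swapO
  have dj := H.disj
  have hm' : ¬ Split a i j l m := fun h' => hm (h.split.swap_right.trans_right h')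
  by_cases h₁ : O i j m
  · rcases H.rule i j k m h.s₁ h₁ with ⟨r1, -⟩ | ⟨r1, -⟩
    · have := h.cases_of_right H h₁ r1
      tauto
    · have := (h.swap_left H).cases_of_right H (H.permO h₁).2.1 r1
      tauto
  -- Against `O i k l`, this would give `i, k, m` or `i, l, m` the colour `O`; then `rule` with `S i
  -- j k` or `S i j l` gives `O i j m` or puts `m` on the right, both excluded.
  by_cases h₂ : S k l m
  · exfalso
    have r0 := H.rule k l m i (by grind) ((H.permO h.o₁).2.2.1)
    have r1 := H.rule i j l m h.s₂
    have r2 := H.rule i l j m (by have := h.s₂; grind)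
    have r3 := H.rule i j k m h.s₁
    have r4 := H.rule i k j m (by have := h.s₁; grind)
    have := @Split.swap_right ι G _ a
    grind
  have key : ∀ i j k l, Dich a S O i j k l → ¬ Split a i j k m → ¬ O i j m → ¬ S k l m →
      ¬ Dich a S O i m k l → skew a i k m = 0 := by
    intro i j k l h hm h₁ h₂ h₃
    by_contra h₀
    rcases H.total _ _ _ h₀ with h₀ | h₀
    · rcases H.rule i k m l h₀ h.o₁ with ⟨r1, r2, r3⟩ | ⟨r1, r2, r3⟩
      · exact h₃ ⟨(H.permS h₀).1, r1, h.o₁, (H.permO r2).2.1, r3⟩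
      · exact h₂ (H.permS r1).1
    · have := H.rule i k j m (H.permS h.s₁).1 h₀
      grind
  by_cases h₃ : Dich a S O i m k l
  · exact .inr (.inl h₃)
  by_cases h₄ : Dich a S O j m k l
  · exact .inr (.inr (.inl h₄))
  refine .inl ⟨key _ _ _ _ h hm h₁ h₂ h₃, key _ _ _ _ (h.swap_left H) (fun h => hm h.swap_left)
    (fun h => h₁ (H.permO h).2.1) h₂ h₄, key _ _ _ _ (h.swap_right H) hm' h₁
    (fun h => h₂ (H.permS h).2.1) (fun h => h₃ (h.swap_right H)),
    key _ _ _ _ ((h.swap_right H).swap_left H) (fun h => hm' h.swap_left)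
    (fun h => h₁ (H.permO h).2.1) (fun h => h₂ (H.permS h).2.1) (fun h => h₄ (h.swap_right H))⟩

/-! ### Pentagons and the attachment of a single index. -/

/-- The two values taken by `skew` on a pentagon. -/
lemma Pent.skew_eq {u v w x y : ι} (h : Pent a S O u v w x y) :
    (skew a v w x = skew a u v w ∧ skew a w x y = skew a u v w ∧ skew a x y u = skew a u v w ∧
      skew a y u v = skew a u v w) ∧
    (skew a v w y = skew a u v x ∧ skew a w x u = skew a u v x ∧ skew a x y v = skew a u v x ∧
      skew a y u w = skew a u v x) := by
  have e0 := h.d₀.skew_eq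
  have e1 := h.d₁.skew_eq
  have e2 := h.d₂.skew_eq
  have e3 := h.d₃.skew_eq
  have e4 := h.d₄.skew_eq
  have f0 := h.d₀.skew_eq'
  have f1 := h.d₁.skew_eq'
  have f2 := h.d₂.skew_eq'
  have f3 := h.d₃.skew_eq'
  have f4 := h.d₄.skew_eq'
  have r := @skew_rot ι G _ a
  grind

lemma Pent.rotate {u v w x y : ι} (h : Pent a S O u v w x y) : Pent a S O v w x y u :=
  ⟨h.s₁, h.s₂, h.s₃, h.s₄, h.s₀, h.o₁, h.o₂, h.o₃, h.o₄, h.o₀, h.d₁, h.d₂, h.d₃, h.d₄, h.d₀⟩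

lemma Coloring.ne (H : Coloring a S O) {i j k : ι} (h : S i j k) : i ≠ j ∧ i ≠ k ∧ j ≠ k := by
  have := H.neS _ _ _ h
  refine ⟨?_, ?_, ?_⟩ <;> rintro rfl <;> exact this (by unfold skew; abel)

/-- If both held, the resulting split would make the two `skew` values opposite; if both failed,
`Extends` would attach `x` to the other side in both directions and make them equal. -/
lemma Pent.xor_cross (H : Coloring a S O) (hE : Extends a) {u v w x y : ι}
    (h : Pent a S O u v w x y) (h₁ : skew a u v w ≠ skew a u v x)
    (h₂ : skew a u v w ≠ - skew a u v x) : ¬ (Cross a u x w y ↔ Cross a w y u x) := by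
  intro hc
  have r := @skew_rot ι G _ a
  have s := @skew_swap ι G _ a
  have e := h.skew_eq
  by_cases hx : Cross a u x w y
  · have : Split a u x w y := ⟨hx, hc.1 hx⟩
    have := this.skew_eq
    grind
  · obtain ⟨n1, n2, n3⟩ := H.ne h.s₀
    obtain ⟨n4, n5, n6⟩ := H.ne h.s₄
    have c1 := (hE u v w y x n2 n4.symm n3 n5.symm h.d₀.1).resolve_left hx
    have c2 := (hE w y u v x n2.symm n3.symm n4 n5 h.d₀.2).resolve_right (fun h => hx (hc.2 h))
    exact h₁ (Split.skew_eq ⟨c1, c2⟩)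

lemma Pent.not_cross {u v w x y : ι} (h : Pent a S O u v w x y)
    (hc : ¬ Cross a w y u x) : ¬ Cross a v y x u :=
  fun h' => hc (h.d₁.1.trans_left h').swap_right

lemma Pent.not_cross' {u v w x y : ι} (h : Pent a S O u v w x y)
    (hc : ¬ Cross a u x w y) : ¬ Cross a x u v y :=
  fun h' => hc (h.d₁.2.trans_right h').swap_left

/-- `Extends` treats the two blocks separately. Either `skew` equality makes one of the attachments
hold in both directions or in neither, so the blocks cannot be forced to different sides. -/
lemma Extends.split (hE : Extends a) {i j k l : ι} (m : ι) (h : Split a i j k l) (n1 : i ≠ k)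
    (n2 : i ≠ l) (n3 : j ≠ k) (n4 : j ≠ l)
    (he : skew a i j k = skew a i j m ∨ skew a i m k = skew a i m l) :
    Split a i m k l ∨ Split a i j k m := by
  have c1 := hE i j k l m n1 n2 n3 n4 h.1
  have c2 := hE k l i j m n1.symm n3.symm n2.symm n4.symm h.2
  have c2' : Cross a k l i m ∨ Cross a k m i j := c2.symm
  rcases he with he | he <;> have := cross_comm_of_skew_eq he <;> unfold Split <;> tauto

/-- On a pentagon, the exceptional index `x` can be attached to one of the sides of the split
`{u, v} | {w, y}`. -/
lemma Pent.split_or (H : Coloring a S O) (hE : Extends a) {u v w x y : ι}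
    (h : Pent a S O u v w x y) : Split a u x w y ∨ Split a u v w x := by
  have r := @skew_rot ι G _ a
  have s := @skew_swap ι G _ a
  have e := h.skew_eq
  have e1 := h.rotate.skew_eq
  obtain ⟨n1, n2, n3⟩ := H.ne h.s₀
  obtain ⟨n4, n5, n6⟩ := H.ne h.s₄
  by_cases h₁ : skew a u v w = skew a u v x
  · exact hE.split x h.d₀ n2 n4.symm n3 n5.symm (.inl h₁)
  by_cases h₂ : skew a u v w = - skew a u v x
  · exact hE.split x h.d₀ n2 n4.symm n3 n5.symm (.inr (by grind))
  have x0 := h.xor_cross H hE h₁ h₂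
  have x1 := h.rotate.xor_cross H hE (by grind) (by grind)
  have x2 := h.rotate.rotate.xor_cross H hE (by grind) (by grind)
  have x3 := h.rotate.rotate.rotate.xor_cross H hE (by grind) (by grind)
  have x4 := h.rotate.rotate.rotate.rotate.xor_cross H hE (by grind) (by grind)
  have y0 := h.not_cross
  have y1 := h.rotate.not_cross
  have y2 := h.rotate.rotate.not_cross
  have y3 := h.rotate.rotate.rotate.not_cross
  have y4 := h.rotate.rotate.rotate.rotate.not_cross
  have z0 := h.not_cross'
  have z1 := h.rotate.not_cross'
  have z2 := h.rotate.rotate.not_cross'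
  have z3 := h.rotate.rotate.rotate.not_cross'
  have z4 := h.rotate.rotate.rotate.rotate.not_cross'
  have sw : ∀ i j k l, Cross a i j k l ↔ Cross a i j l k :=
    fun i j k l => ⟨Cross.swap_right, Cross.swap_right⟩
  have sw' : ∀ i j k l, Cross a i j k l ↔ Cross a j i k l :=
    fun i j k l => ⟨Cross.swap_left, Cross.swap_left⟩
  -- For each rotation exactly one of the two crosses holds, and `not_cross`, `not_cross'` make the
  -- choice alternate from one rotation to the next; five is odd.
  exfalso
  grind

/-- Every further index can be attached to one side of a dichromatic split. -/
lemma Dich.split_or (H : Coloring a S O) (hE : Extends a) {i j k l : ι} (h : Dich a S O i j k l)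
    (m : ι) : Split a i m k l ∨ Split a i j k m := by
  by_contra! hn
  have r := @skew_rot ι G _ a
  have s := @skew_swap ι G _ a
  obtain ⟨n1, n2, n3⟩ := H.ne h.s₁
  obtain ⟨n4, n5, n6⟩ := H.ne h.s₂
  rcases h.cases H hn.2 with h' | h' | h' | h' | h'
  · have := hE.split m h.split n2 n5 n3 n6 (.inl (by
      have := skew_cocycle (a := a) i j k m
      grind))
    tauto
  · exact hn.1 h'.split
  · exact hn.1 (h.split.swap_left.trans_left h'.split)
  · rcases h'.split_or H hE with h'' | h''
    · exact hn.1 h''.swap_right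
    · exact hn.2 (h.split.swap_right.trans_right h'')
  · rcases h'.split_or H hE with h'' | h''
    · exact hn.1 (h.split.swap_left.trans_left h''.swap_right)
    · exact hn.2 (h.split.swap_right.trans_right h''.swap_left)

/-- If the split failed, `Extends.split` and `Dich.split_or` would leave only pentagons, both for
`m` and, by duality, for `n`. Two of the four combinations contradict the `skew` values; in the
other two `rule` forces a further split that does. -/
lemma Dich.split_of_opposite (H : Coloring a S O) (hE : Extends a) {i j k l m n : ι}
    (h : Dich a S O i j k l) (hm : ¬ Split a i j k m) (hn : ¬ Split a i n k l) :
    Split a i m k n := by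
  by_contra hc
  have r := @skew_rot ι G _ a
  have s := @skew_swap ι G _ a
  have A := (h.split_or H hE m).resolve_right hm
  have B := (h.split_or H hE n).resolve_left hn
  obtain ⟨n1, n2, n3⟩ := H.ne h.s₁
  obtain ⟨n4, n5, n6⟩ := H.ne h.s₂
  have e1 : skew a i j k ≠ skew a i j m := fun he => by
    have := hE.split m B n2 (by rintro rfl; exact hn (split_self_left ..)) n3
      (by rintro rfl; exact hn h.split) (.inl he)
    tauto
  have mk : m ≠ k := by rintro rfl; exact hm (split_self_right ..)
  have ml : m ≠ l := by rintro rfl; exact hm h.split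
  have e2 : skew a i n k ≠ skew a i n l := fun he => by
    have := hE.split n A n2 n5 mk ml (.inr he)
    tauto
  have e3 : skew a i m k ≠ skew a i m n := fun he => by
    have := hE.split n A n2 n5 mk ml (.inl he)
    tauto
  have d1 : ¬ Dich a S O i m k l := fun h' => by
    have := h'.split_or H hE n
    tauto
  have d2 : ¬ Dich a S O j m k l := fun h' => by
    rcases h'.split_or H hE n with h'' | h''
    · exact hn (h.split.swap_left.trans_left h'')
    · exact hc (B.swap_left.trans_left h'')
  have d3 : ¬ Dich a O S k n i j := fun h' => by
    have := (h'.symm H.dual).split_or H hE m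
    tauto
  have d4 : ¬ Dich a O S l n i j := fun h' => by
    rcases (h'.symm H.dual).split_or H hE m with h'' | h''
    · exact hc (A.swap_right.trans_right h'')
    · exact hm (h.split.swap_right.trans_right h'')
  have A1 := A.skew_eq
  have A2 := A.skew_eq'
  have B1 := B.skew_eq
  have B2 := B.skew_eq'
  rcases h.cases H hm with ⟨z1, z2, -⟩ | h' | h' | P | P
  · exact e1 ((skew_eq_iff ..).2 (z1.trans z2.symm))
  · exact d1 h'
  · exact d2 h'
  all_goals
    rcases (h.symm H).cases H.dual (fun h => hn h.symm) with ⟨z1, z2, -⟩ | h' | h' | Q | Q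
    · grind
    · exact d3 h'
    · exact d4 h'
    all_goals
      have p := P.skew_eq
      have q := Q.skew_eq
  · have t := H.rule i k m n (H.permS P.s₃).2.2.2.2 (H.permO Q.s₃).2.2.1
    have t' := (t.resolve_left (fun t => hc t.2.2)).2.2.skew_eq'
    grind
  · grind
  · grind
  · have hc' : ¬ Split a j m k n := fun t => hc (B.swap_left.trans_left t)
    have t := H.rule j k m n (H.permS P.s₃).2.2.2.2 (H.permO Q.s₁).2.1
    have t' := (t.resolve_left (fun t => hc' t.2.2)).2.2.skew_eq'
    have e4 : skew a j m k ≠ skew a j m n := fun he => by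
      rcases hE.split n (h.split.trans_left A) n3 n6 mk ml (.inl he) with t | t
      · exact hn (h.split.swap_left.trans_left t)
      · exact hc' t
    grind

/-- By `B` it suffices that `skew a i m n = skew a j m n`. In `Dich.replace` this excludes
pentagons, since there `Extends.split` forbids the equality. -/
lemma Pent.attach (H : Coloring a S O) {i j k l m n : ι} (P : Pent a S O i j l m k)
    (A : Split a i m k l) (B : Split a i j k n) (C : Split a i n k l)
    (hc : ¬ Split a i m k n) : skew a i j k = skew a i j m := by
  have r := @skew_rot ι G _ a
  have s := @skew_swap ι G _ a
  have p := P.skew_eq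
  have A' : Split a j m k l := P.d₀.swap_right.trans_left A
  have h₁ : ¬ Split a j m k n := fun t => hc (B.swap_left.trans_left t)
  have h₂ : ¬ Split a i m l n := fun t => hc (A.swap_right.trans_right t)
  have h₃ : ¬ Split a j m l n := fun t => h₁ (A'.swap_right.trans_right t)
  have A1 := A.skew_eq
  have A2 := A.skew_eq'
  have B1 := B.skew_eq
  have B2 := B.skew_eq'
  have C1 := C.skew_eq
  have C2 := C.skew_eq'
  have C3 := (P.d₀.swap_right.trans_left C).skew_eq
  have rS := H.rotS
  have sS := H.swapS
  have rO := H.rotO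
  have sO := H.swapO
  have dj := H.disj
  have mn : skew a i m n = skew a j m n → skew a i j k = skew a i j m := fun t =>
    B1.trans ((skew_eq_iff ..).2 t).symm
  have ikm : S i k m := (H.permS P.s₃).2.2.2.2
  have ilm : O i l m := (H.permO P.o₂).2.2.2.1
  have jkm : O j k m := (H.permO P.o₃).2.2.2.2
  have jlm : S j l m := P.s₁
  by_cases z : skew a i k n = 0
  · apply mn
    have z1 : skew a j k n = 0 := by grind
    have z2 : skew a i l n = 0 := by grind
    have z3 : skew a j l n = 0 := by grind
    have nS := H.neS
    have nO := H.neO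
    have key : ∀ u v w, S u v m → O u w m → skew a u v n = 0 → skew a u w n = 0 →
        skew a u m n = 0 := by
      intro u v w h1 h2 h3 h4
      by_contra h
      rcases H.total _ _ _ h with h | h
      · have := H.rule u m n w h (by grind)
        grind
      · have := H.rule u m v n (by grind) h
        grind
    rw [key i k l ikm ilm z z2, key j l k jlm jkm z3 z1]
  · have z1 : skew a j k n ≠ 0 := by grind
    have z2 : skew a i l n ≠ 0 := by grind
    have z3 : skew a j l n ≠ 0 := by grind
    have t1 := H.total _ _ _ z
    have t2 := H.total _ _ _ z1
    have t3 := H.total _ _ _ z2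
    have t4 := H.total _ _ _ z3
    have kl_i : O i k l := (H.permO P.o₄).2.1
    have kl_j : O j k l := (H.permO P.o₁).1
    have g1 : O i k n → O i m n ∧ Split a k m i n := fun t =>
      ((H.rule i k m n ikm t).resolve_left fun t => hc t.2.2).2
    have g2 : S i l n → S i n m ∧ Split a i n l m := fun t => by
      have := (H.rule i l n m t ilm).resolve_right fun t => h₂ t.2.2.symm
      exact ⟨this.1, this.2.2⟩
    have g3 : S j k n → S j n m ∧ Split a j n k m := fun t => by
      have := (H.rule j k n m t jkm).resolve_right fun t => h₁ t.2.2.symm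
      exact ⟨this.1, this.2.2⟩
    have g4 : O j l n → O j m n ∧ Split a l m j n := fun t =>
      ((H.rule j l m n jlm t).resolve_left fun t => h₃ t.2.2).2
    have s1 : O i k n → skew a k m i = skew a k m n := fun t => (g1 t).2.skew_eq
    have s1' : O i k n → skew a k i n = skew a m i n := fun t => (g1 t).2.skew_eq'
    have s2 : S i l n → skew a i n l = skew a i n m := fun t => (g2 t).2.skew_eq
    have s3 : S j k n → skew a j n k = skew a j n m := fun t => (g3 t).2.skew_eq
    have s4 : O j l n → skew a l j n = skew a m j n := fun t => (g4 t).2.skew_eq'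
    have ex1 : ¬ (O i k n ∧ S i l n) := by grind
    have ex2 : ¬ (S j k n ∧ O j l n) := by grind
    have s₂₃ : ∀ u v w, skew a u w v = - skew a u v w := fun u v w => by
      rw [← r u w v, s v w u, r u v w]
    have aux : O j k n → S j l n → (S i k n ∧ O i l n) ∨ (S i l n ∧ O i k n) := fun h1 h2 => by
      have a1 : S k l n := by
        have := H.rule j l n k h2 (by grind)
        grind
      have := H.rule k l n i a1 (by grind)
      grind
    -- This is the pattern at `i` to which neither `g1` nor `g2` applies; both sides are then
    -- compared with the triple `k, m, n`. Otherwise `aux` and `ex1` exclude the corresponding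
    -- pattern at `j`, and `m` can be exchanged for `k` on both sides.
    by_cases c : S i k n ∧ O i l n
    · have a1 : S k l n := by
        have := H.rule i k n l c.1 kl_i
        grind
      have a2 : O j k n ∧ Split a l n k j := by
        have := H.rule l k n j (by grind) (by grind)
        grind
      have kij := P.s₄
      have a3 : Split a k i n j := by
        have := H.rule k n i j (by grind) (by grind)
        grind
      have b1 := (P.d₂.trans_left a2.2).skew_eq
      have b2 := (a3.swap_right.trans_right P.d₄).skew_eq'
      apply mn
      rw [s₂₃ i n m, ← b2, s₂₃ k m n, neg_neg, ← r k m n, b1, r j m n]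
    · apply mn
      have c1 : skew a i m n = skew a i k n := by
        rcases (by grind : O i k n ∨ S i l n) with c1 | c1
        · rw [s m i, ← s1' c1, ← s k i]
        · rw [s₂₃ i n m, ← s2 c1, ← C1, ← s₂₃ i n k]
      have c2 : skew a j m n = skew a j k n := by
        rcases (by grind : S j k n ∨ O j l n) with c2 | c2
        · rw [s₂₃ j n m, ← s3 c2, ← s₂₃ j n k]
        · rw [s m j, ← s4 c2, ← s l j, s₂₃ j n l, ← C3, ← s₂₃ j n k]
      rw [c1, c2, B2]

/-- If `n` can be attached to both sides of a dichromatic split, but not to the right of an index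
`m` on the left, then `m` replaces one of the two left indices. -/
lemma Dich.replace (H : Coloring a S O) (hE : Extends a) {i j k l m n : ι}
    (h : Dich a S O i j k l) (ni : i ≠ n) (nj : j ≠ n) (hm : ¬ Split a i j k m)
    (B : Split a i j k n) (C : Split a i n k l) (hc : ¬ Split a i m k n) :
    Dich a S O i m k l ∨ Dich a S O j m k l := by
  have A := (h.split_or H hE m).resolve_right hm
  obtain ⟨n1, n2, n3⟩ := H.ne h.s₁
  have e : skew a i j k ≠ skew a i j m := fun he => by
    have := hE.split m B n2 ni n3 nj (.inl he)
    tauto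
  rcases h.cases H hm with ⟨z1, z2, -⟩ | h' | h' | P | P
  · exact absurd ((skew_eq_iff ..).2 (z1.trans z2.symm)) e
  · exact .inl h'
  · exact .inr h'
  · exact absurd (P.attach H A B C hc) e
  · refine absurd (P.attach H (h.split.trans_left A) B.swap_left (h.split.trans_left C)
      fun t => hc (B.swap_left.trans_left t)) fun t => e ?_
    have s := @skew_swap ι G _ a
    grind

end Coloring

end PrincipalMinors

namespace PrincipalMinors

/-! ### From a dichromatic split to a cut. -/

section Linked

variable {ι G : Type*} [AddCommGroup G] {a : ι → ι → G} {S O : ι → ι → ι → Prop}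

/-- The pairs of left indices obtained from `i, j` by successive replacements as in
`Dich.replace`. -/
inductive Linked (a : ι → ι → G) (S O : ι → ι → ι → Prop) (i j k l : ι) : ι → ι → Prop
  | base : Linked a S O i j k l i j
  | left {p q x : ι} : Linked a S O i j k l p q → Dich a S O p x k l → Linked a S O i j k l p x
  | right {p q x : ι} : Linked a S O i j k l p q → Dich a S O q x k l → Linked a S O i j k l q x

lemma Linked.dich {i j k l p q : ι} (h : Dich a S O i j k l) (hL : Linked a S O i j k l p q) :
    Dich a S O p q k l := by
  induction hL <;> assumption

/-- Successive pairs share an index, so the splits chain back to `i`. -/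
lemma Linked.split {i j k l p q y : ι} (hL : Linked a S O i j k l p q)
    (hy : ∀ p q, Linked a S O i j k l p q → Split a p q k y) :
    Split a i p k y ∧ Split a i q k y := by
  induction hL with
  | base => exact ⟨split_self_left .., hy _ _ .base⟩
  | left hL hd ih => exact ⟨ih.1, ih.1.swap_left.trans_left (hy _ _ (hL.left hd))⟩
  | right hL hd ih => exact ⟨ih.2, ih.2.swap_left.trans_left (hy _ _ (hL.right hd))⟩

lemma Dich.exists_cut (H : Coloring a S O) (hE : Extends a) {i j k l : ι}
    (h : Dich a S O i j k l) : ∃ X : Set ι, i ∈ X ∧ j ∈ X ∧ k ∉ X ∧ l ∉ X ∧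
      ∀ x ∈ X, ∀ y ∉ X, Split a i x k y := by
  -- `X` collects the members of linked pairs and every index that cannot go to the right of some
  -- linked pair. Hence an index outside `X` goes to the right of all of them.
  refine ⟨{x | ∃ p q, Linked a S O i j k l p q ∧ (x = p ∨ x = q ∨ ¬ Split a p q k x)},
    ⟨i, j, .base, .inl rfl⟩, ⟨i, j, .base, .inr (.inl rfl)⟩, ?_, ?_, ?_⟩
  · rintro ⟨p, q, hL, h' | h' | h'⟩
    · exact (H.ne (hL.dich h).s₁).2.1 h'.symm
    · exact (H.ne (hL.dich h).s₁).2.2 h'.symm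
    · exact h' (split_self_right ..)
  · rintro ⟨p, q, hL, h' | h' | h'⟩
    · exact (H.ne (hL.dich h).s₂).2.1 h'.symm
    · exact (H.ne (hL.dich h).s₂).2.2 h'.symm
    · exact h' (hL.dich h).split
  · rintro x ⟨p, q, hL, hx⟩ y hy
    have hy' : ∀ p q, Linked a S O i j k l p q → y ≠ p ∧ y ≠ q ∧ Split a p q k y := by
      intro p q hL
      simp only [Set.mem_ofPred_eq, not_exists, not_and, not_or, not_not] at hy
      exact hy p q hL
    have hs : ∀ p q, Linked a S O i j k l p q → Split a p q k y := fun p q hL => (hy' p q hL).2.2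
    have hpq := hL.split hs
    rcases hx with rfl | rfl | hx
    · exact hpq.1
    · exact hpq.2
    · refine hpq.1.swap_left.trans_left ?_
      by_contra hc
      have hd := hL.dich h
      -- If `y` also fits on the left, `replace` puts `x` into a new linked pair, to whose right `y`
      -- goes. Otherwise `x` and `y` are forced to opposite sides.
      by_cases hpy : Split a p y k l
      · obtain ⟨n1, n2, B⟩ := hy' p q hL
        rcases hd.replace H hE n1.symm n2.symm hx B hpy hc with h' | h'
        · exact hc (hs _ _ (hL.left h'))
        · exact hc (B.swap_left.trans_left (hs _ _ (hL.right h')))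
      · exact hc (hd.split_of_opposite H hE hx hpy)

/-- If both colours occur, then they occur on two triples with two common indices. -/
lemma Coloring.exists_adjacent (H : Coloring a S O) {i j k u v w : ι} (h : S i j k)
    (h' : O u v w) : ∃ i j k l, S i j k ∧ O i j l := by
  by_contra! hn
  have nO := H.neO
  have nS := H.neS
  have rS := H.rotS
  have sS := H.swapS
  have rO := H.rotO
  have sO := H.swapO
  -- The other three faces share a pair with `i, j, k`, so none has colour `O`. If none had colour
  -- `S`, their `skew` would vanish and the cocycle identity would give `skew a i j k = 0`.
  have extend : ∀ i j k l, S i j k → S i j l ∨ S i k l ∨ S j k l := by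
    intro i j k l h
    by_contra! hc
    have z : ∀ u v, S u v i ∨ S u v j ∨ S u v k → ¬ S u v l → skew a u v l = 0 := by
      intro u v h1 h2
      by_contra h3
      rcases H.total _ _ _ h3 with h3 | h3
      · exact h2 h3
      · grind
    have := skew_cocycle (a := a) i j k l
    have z1 := z i j (by grind) hc.1
    have z2 := z i k (by grind) hc.2.1
    have z3 := z j k (by grind) hc.2.2
    grind
  have extendO : ∀ i j k l, O i j k → O i j l ∨ O i k l ∨ O j k l := by
    intro i j k l h
    by_contra! hc
    have z : ∀ u v, O u v i ∨ O u v j ∨ O u v k → ¬ O u v l → skew a u v l = 0 := by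
      intro u v h1 h2
      by_contra h3
      rcases H.total _ _ _ h3 with h3 | h3
      · grind
      · exact h2 h3
    have := skew_cocycle (a := a) i j k l
    have z1 := z i j (by grind) hc.1
    have z2 := z i k (by grind) hc.2.1
    have z3 := z j k (by grind) hc.2.2
    grind
  -- Extending by `m` forces `S i j m`, and extending the other triple by `i` forces `O m n i`;
  -- these share the pair `i, m`.
  have meet : ∀ l i j m n, S l i j → O l m n → False := by
    intro l i j m n h1 h2
    have e1 := extend l i j m h1
    have e2 := extendO l m n i h2
    have e3 := extend l i j n h1
    grind
  have := extend i j k u h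
  grind

end Linked

end PrincipalMinors

namespace PrincipalMinors

/-! ### Rank at most one through `2 × 2` minors. -/

section Minors

variable {m n F : Type*} [Fintype n] [Field F]

lemma mul_eq_mul_of_rank_le_one {M : Matrix m n F} (h : M.rank ≤ 1) (i j : m) (k l : n) :
    M i k * M j l = M i l * M j k := by
  by_contra hne
  have hd : (M.submatrix ![i, j] ![k, l]).det ≠ 0 := by
    rw [Matrix.det_fin_two]
    simpa using sub_ne_zero.2 hne
  have h1 := Matrix.rank_of_det_ne_zero hd
  have h2 := Matrix.rank_submatrix_le M ![i, j] ![k, l]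
  rw [Fintype.card_fin] at h1
  omega

lemma rank_le_one_of_mul_eq_mul {M : Matrix m n F} (i₀ : m) (k₀ : n) (h₀ : M i₀ k₀ ≠ 0)
    (h : ∀ i k, M i k * M i₀ k₀ = M i k₀ * M i₀ k) : M.rank ≤ 1 := by
  have : M = Matrix.vecMulVec (fun i => M i k₀ / M i₀ k₀) (fun k => M i₀ k) := by
    ext i k
    rw [Matrix.vecMulVec_apply, div_mul_eq_mul_div, eq_div_iff h₀, h]
  rw [this]
  exact Matrix.rank_vecMulVec_le _ _

lemma one_le_rank_of_ne_zero {M : Matrix m n F} {i : m} {k : n} (h : M i k ≠ 0) : 1 ≤ M.rank := by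
  have hd : (M.submatrix ![i] ![k]).det ≠ 0 := by
    rw [Matrix.det_fin_one]
    simpa using h
  have h1 := Matrix.rank_of_det_ne_zero hd
  have h2 := Matrix.rank_submatrix_le M ![i] ![k]
  rw [Fintype.card_fin] at h1
  omega

end Minors

/-! ### Translation of matrix entries to the additive setting. -/

section LogEntry

variable {ι F : Type*} [Field F] {A : Matrix ι ι F}

/-- The cyclic product of three entries. -/
def cyc (A : Matrix ι ι F) (i j k : ι) : F := A i j * A j k * A k i

lemma cyc_rot (A : Matrix ι ι F) (i j k : ι) : cyc A j k i = cyc A i j k := by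
  unfold cyc; ring

lemma ne_of_skew_ne_zero {G : Type*} [AddCommGroup G] {a : ι → ι → G} {i j k : ι}
    (h : skew a i j k ≠ 0) : i ≠ j ∧ i ≠ k ∧ j ≠ k := by
  refine ⟨?_, ?_, ?_⟩ <;> rintro rfl <;> exact h (by unfold skew; abel)

variable [DecidableEq ι]

/-- The off-diagonal entries of a dense matrix as elements of the additive group of units, with
diagonal entries replaced by `1`. -/
def logEntry (hA : IsDense A) (i j : ι) : Additive Fˣ :=
  if h : i = j then 0 else Additive.ofMul (Units.mk0 (A i j) (hA i j h))

lemma logEntry_of_ne (hA : IsDense A) {i j : ι} (h : i ≠ j) :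
    logEntry hA i j = Additive.ofMul (Units.mk0 (A i j) (hA i j h)) := dif_neg h

lemma cross_logEntry (hA : IsDense A) {i j k l : ι} (h1 : i ≠ k) (h2 : i ≠ l) (h3 : j ≠ k)
    (h4 : j ≠ l) : Cross (logEntry hA) i j k l ↔ A i k * A j l = A i l * A j k := by
  unfold Cross
  rw [logEntry_of_ne hA h1, logEntry_of_ne hA h2, logEntry_of_ne hA h3, logEntry_of_ne hA h4,
    ← ofMul_mul, ← ofMul_mul, EmbeddingLike.apply_eq_iff_eq, Units.ext_iff]
  simp

lemma skew_logEntry (hA : IsDense A) {i j k : ι} (h1 : i ≠ j) (h2 : i ≠ k) (h3 : j ≠ k) :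
    skew (logEntry hA) i j k = 0 ↔ cyc A i j k = cyc A j i k := by
  unfold skew cyc
  rw [sub_eq_zero, logEntry_of_ne hA h1, logEntry_of_ne hA h2, logEntry_of_ne hA h3,
    logEntry_of_ne hA h1.symm, logEntry_of_ne hA h2.symm, logEntry_of_ne hA h3.symm,
    ← ofMul_mul, ← ofMul_mul, ← ofMul_mul, ← ofMul_mul, EmbeddingLike.apply_eq_iff_eq,
    Units.ext_iff]
  simp only [Units.val_mul, Units.val_mk0]
  constructor <;> intro h <;> linear_combination h

/-- The side of `X` on which `m` falls decides the alternative. -/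
lemma RankOneExtension.extends [Fintype ι] (hA : IsDense A) (hR : RankOneExtension A) :
    Extends (logEntry hA) := by
  intro i j k l m h1 h2 h3 h4 h
  by_cases hij : i = j
  · subst hij
    exact .inr (cross_self_left ..)
  by_cases hkl : k = l
  · subst hkl
    exact .inl (cross_self_right ..)
  rw [cross_logEntry hA h1 h2 h3 h4] at h
  have hr : (sub A {i, j} {k, l}).rank = 1 := by
    refine le_antisymm ?_ (one_le_rank_of_ne_zero (i := ⟨i, by simp⟩) (k := ⟨k, by simp⟩)
      (hA i k h1))
    refine rank_le_one_of_mul_eq_mul ⟨i, by simp⟩ ⟨k, by simp⟩ (hA i k h1) ?_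
    rintro ⟨x, hx⟩ ⟨y, hy⟩
    simp only [Finset.mem_insert, Finset.mem_singleton] at hx hy
    simp only [sub, Matrix.submatrix_apply]
    rcases hx with rfl | rfl <;> rcases hy with rfl | rfl <;> first | ring1 | linear_combination h
  obtain ⟨X, hi, hj, hk, hl, hX⟩ := hR i j k l (by simp [*]) hr
  have hs : ∀ x ∈ X, ∀ x' ∈ X, ∀ y ∈ Xᶜ, ∀ y' ∈ Xᶜ, Cross (logEntry hA) x x' y y' := by
    intro x hx x' hx' y hy y' hy'
    have ne : ∀ x ∈ X, ∀ y ∈ Xᶜ, x ≠ y := by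
      rintro x hx y hy rfl
      exact Finset.mem_compl.1 hy hx
    rw [cross_logEntry hA (ne _ hx _ hy) (ne _ hx _ hy') (ne _ hx' _ hy) (ne _ hx' _ hy')]
    exact mul_eq_mul_of_rank_le_one hX.le ⟨x, hx⟩ ⟨x', hx'⟩ ⟨y, hy⟩ ⟨y', hy'⟩
  by_cases hm : m ∈ X
  · exact .inl (hs _ hi _ hm _ hk _ hl)
  · exact .inr (hs _ hi _ hj _ hk _ (Finset.mem_compl.2 hm))

end LogEntry

/-! ### Cyclic sums determined by minors of order at most four. -/

section SmallMinors

variable {ι F : Type*} [Field F] {A B : Matrix ι ι F}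

/-- The sum of the cyclic products of length four on `i, j, k, l`. -/
def cycSum (A : Matrix ι ι F) (i j k l : ι) : F :=
  A i j * A j k * A k l * A l i + A i j * A j l * A l k * A k i + A i k * A k j * A j l * A l i +
  A i k * A k l * A l j * A j i + A i l * A l j * A j k * A k i + A i l * A l k * A k j * A j i

lemma det_sub_map [DecidableEq ι] {m : ℕ} (A : Matrix ι ι F) (v : Fin m ↪ ι) :
    (sub A (Finset.univ.map v) (Finset.univ.map v)).det = (A.submatrix v v).det := by
  let e : Fin m ≃ (Finset.univ.map v : Finset ι) :=
    Equiv.ofBijective (fun i => ⟨v i, by simp⟩) ⟨fun i j h => v.injective (by simpa using h), by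
      rintro ⟨x, hx⟩
      simp only [Finset.mem_map, Finset.mem_univ, true_and] at hx
      obtain ⟨i, rfl⟩ := hx
      exact ⟨i, rfl⟩⟩
  rw [← Matrix.det_submatrix_equiv_self e]
  rfl

/-- Grouping by cycle type isolates the four-cycles, which are odd permutations; all other terms are
determined by smaller minors. -/
lemma det_fin_four (M : Matrix (Fin 4) (Fin 4) F) :
    M.det = M 0 0 * M 1 1 * M 2 2 * M 3 3 - M 0 1 * M 1 0 * M 2 2 * M 3 3
      - M 0 2 * M 2 0 * M 1 1 * M 3 3 - M 0 3 * M 3 0 * M 1 1 * M 2 2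
      - M 1 2 * M 2 1 * M 0 0 * M 3 3 - M 1 3 * M 3 1 * M 0 0 * M 2 2
      - M 2 3 * M 3 2 * M 0 0 * M 1 1 + M 0 1 * M 1 0 * M 2 3 * M 3 2
      + M 0 2 * M 2 0 * M 1 3 * M 3 1 + M 0 3 * M 3 0 * M 1 2 * M 2 1
      + (cyc M 0 1 2 + cyc M 1 0 2) * M 3 3 + (cyc M 0 1 3 + cyc M 1 0 3) * M 2 2
      + (cyc M 0 2 3 + cyc M 2 0 3) * M 1 1 + (cyc M 1 2 3 + cyc M 2 1 3) * M 0 0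
      - cycSum M 0 1 2 3 := by
  rw [Matrix.det_succ_row_zero]
  simp [Fin.sum_univ_succ, Matrix.det_fin_three, Fin.succAbove]
  unfold cyc cycSum
  ring

/-- Equality of the diagonal entries and of the sums of cyclic products of length at most four. -/
structure CycEq (A B : Matrix ι ι F) : Prop where
  diag : ∀ i, A i i = B i i
  pair : ∀ i j, i ≠ j → A i j * A j i = B i j * B j i
  triple : ∀ i j k, i ≠ j → i ≠ k → j ≠ k → cyc A i j k + cyc A j i k = cyc B i j k + cyc B j i k
  quad : ∀ i j k l, i ≠ j → i ≠ k → i ≠ l → j ≠ k → j ≠ l → k ≠ l →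
    cycSum A i j k l = cycSum B i j k l

variable [DecidableEq ι]

lemma PMEUpTo.det_eq {d m : ℕ} (h : PMEUpTo d A B) (hm : m ≤ d) {v : Fin m → ι}
    (hv : Function.Injective v) : (A.submatrix v v).det = (B.submatrix v v).det := by
  have := h (Finset.univ.map ⟨v, hv⟩) (by simpa using hm)
  rwa [det_sub_map, det_sub_map] at this

lemma PMEUpTo.cycEq (h : PMEUpTo 4 A B) : CycEq A B := by
  have diag : ∀ i, A i i = B i i := by
    intro i
    have := h.det_eq (v := ![i]) (by norm_num) (Function.injective_of_subsingleton _)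
    rw [Matrix.det_fin_one, Matrix.det_fin_one] at this
    simpa using this
  have pair : ∀ i j, i ≠ j → A i j * A j i = B i j * B j i := by
    intro i j hij
    have := h.det_eq (v := ![i, j]) (by norm_num) (by
      intro x y; fin_cases x <;> fin_cases y <;> simp [hij, hij.symm])
    simp only [Matrix.det_fin_two, Matrix.submatrix_apply, Matrix.cons_val_zero,
      Matrix.cons_val_one] at this
    rw [diag, diag] at this
    linear_combination -this
  have triple : ∀ i j k, i ≠ j → i ≠ k → j ≠ k →
      cyc A i j k + cyc A j i k = cyc B i j k + cyc B j i k := by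
    intro i j k h1 h2 h3
    have := h.det_eq (v := ![i, j, k]) (by norm_num) (by
      intro x y; fin_cases x <;> fin_cases y <;> simp [*, Ne.symm])
    rw [Matrix.det_fin_three, Matrix.det_fin_three] at this
    simp [diag] at this
    unfold cyc
    linear_combination this + B i i * pair j k h3 + B j j * pair i k h2 + B k k * pair i j h1
  refine ⟨diag, pair, triple, ?_⟩
  intro i j k l h1 h2 h3 h4 h5 h6
  have := h.det_eq (v := ![i, j, k, l]) (by norm_num) (by
    intro x y; fin_cases x <;> fin_cases y <;> simp [*, Ne.symm])
  rw [det_fin_four, det_fin_four] at this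
  simp [diag, cyc, cycSum] at this
  have t1 := triple i j k h1 h2 h4
  have t2 := triple i j l h1 h3 h5
  have t3 := triple i k l h2 h3 h6
  have t4 := triple j k l h4 h5 h6
  have p1 := pair i j h1
  have p2 := pair i k h2
  have p3 := pair i l h3
  have p4 := pair j k h4
  have p5 := pair j l h5
  have p6 := pair k l h6
  unfold cyc at t1 t2 t3 t4
  unfold cycSum
  linear_combination -this + B l l * t1 + B k k * t2 + B j j * t3 + B i i * t4
    - B k k * B l l * p1 - B j j * B l l * p2 - B j j * B k k * p3 - B i i * B l l * p4
    - B i i * B k k * p5 - B i i * B j j * p6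
    + A k l * A l k * p1 + B i j * B j i * p6 + A j l * A l j * p2 + B i k * B k i * p5
    + A j k * A k j * p3 + B i l * B l i * p4

end SmallMinors

end PrincipalMinors

namespace PrincipalMinors

open scoped Matrix

/-! ### The colouring defined by two matrices. -/

section MatrixColoring

variable {ι F : Type*} [Field F] {A B : Matrix ι ι F}

lemma eq_or_swap_of_add_mul {x y x' y' : F} (hs : x + y = x' + y') (hp : x * y = x' * y') :
    (x' = x ∧ y' = y) ∨ (x' = y ∧ y' = x) := by
  have : (x' - x) * (x' - y) = 0 := by linear_combination (-x') * hs + hp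
  rcases mul_eq_zero.1 this with h | h
  · exact .inl ⟨by linear_combination h, by linear_combination -h - hs⟩
  · exact .inr ⟨by linear_combination h, by linear_combination -h - hs⟩

/-- The two cyclic products multiply to a product of three pair products, so both their sum and
their product are common to `A` and `B`. -/
lemma CycEq.cyc_eq (h : CycEq A B) {i j k : ι} (h1 : i ≠ j) (h2 : i ≠ k) (h3 : j ≠ k) :
    (cyc B i j k = cyc A i j k ∧ cyc B j i k = cyc A j i k) ∨
      (cyc B i j k = cyc A j i k ∧ cyc B j i k = cyc A i j k) := by
  refine eq_or_swap_of_add_mul (h.triple i j k h1 h2 h3) ?_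
  have p1 := h.pair i j h1
  have p2 := h.pair i k h2
  have p3 := h.pair j k h3
  unfold cyc
  calc _ = (A i j * A j i) * (A i k * A k i) * (A j k * A k j) := by ring
    _ = _ := by rw [p1, p2, p3]; ring

/-- The main identity behind the comparison of principal minors of order four, in terms of
the entries of a matrix whose first row and column have been scaled to `1`. -/
lemma flip_cases {x x' y y' z z' Y Y' : F} (hx : x ≠ x') (hz : z ≠ z')
    (hY : (Y = y ∧ Y' = y') ∨ (Y = y' ∧ Y' = y))
    (hq : x * Y + Y * z' + z' * x + x' * Y' + Y' * z + z * x' =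
      x * y + y * z + z * x + x' * y' + y' * z' + z' * x')
    (ht : x * Y * z' + x' * Y' * z = x * y * z + x' * y' * z') :
    (Y = y ∧ Y' = y' ∧ y = x' ∧ y' = x) ∨ (Y = y' ∧ Y' = y ∧ y = z' ∧ y' = z) := by
  have hx' := sub_ne_zero.2 hx
  have hz' := sub_ne_zero.2 hz
  rcases hY with ⟨rfl, rfl⟩ | ⟨rfl, rfl⟩
  · left
    -- Both identities reduce to multiples of `z' - z`; cancelling it leaves two pairs with equal
    -- sum and equal product.
    have e1 : x' + Y' = x + Y := mul_left_cancel₀ hz' (by linear_combination hq)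
    have e2 : x' * Y' = x * Y := mul_left_cancel₀ hz' (by linear_combination ht)
    rcases eq_or_swap_of_add_mul e1.symm e2.symm with h | h
    · exact absurd h.1.symm hx
    · exact ⟨rfl, rfl, h.1.symm, h.2⟩
  · right
    have e1 : z' + Y = z + Y' := mul_left_cancel₀ hx' (by linear_combination hq)
    have e2 : z' * Y = z * Y' := mul_left_cancel₀ hx' (by linear_combination ht)
    rcases eq_or_swap_of_add_mul e1.symm e2.symm with h | h
    · exact absurd h.1.symm hz
    · exact ⟨rfl, rfl, h.1.symm, h.2⟩

/-- The entry `A u v` after scaling row and column `i` to `1`. -/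
def scaled (A : Matrix ι ι F) (i u v : ι) : F := A u v / (A u i * A i v)

lemma cyc_eq_scaled (hA : IsDense A) {i u v : ι} (h1 : i ≠ u) (h2 : i ≠ v) :
    cyc A i u v = scaled A i u v * (A i u * A u i * (A i v * A v i)) := by
  have := hA _ _ h1.symm
  have := hA _ _ h2
  unfold cyc scaled
  field_simp

lemma cyc_eq_scaled_swap (hA : IsDense A) {i u v : ι} (h1 : i ≠ u) (h2 : i ≠ v) :
    cyc A u i v = scaled A i v u * (A i u * A u i * (A i v * A v i)) := by
  rw [← cyc_rot, cyc_eq_scaled hA h2 h1, mul_comm (A i u * A u i)]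

lemma cyc_eq_scaled' (hA : IsDense A) {i u v w : ι} (h1 : i ≠ u) (h2 : i ≠ v) (h3 : i ≠ w) :
    cyc A u v w = scaled A i u v * scaled A i v w * scaled A i w u *
      (A i u * A u i * (A i v * A v i) * (A i w * A w i)) := by
  have := hA _ _ h1.symm
  have := hA _ _ h2.symm
  have := hA _ _ h3.symm
  have := hA _ _ h1
  have := hA _ _ h2
  have := hA _ _ h3
  unfold cyc scaled
  field_simp

lemma cycSum_eq_scaled (hA : IsDense A) {i u v w : ι} (h1 : i ≠ u) (h2 : i ≠ v) (h3 : i ≠ w) :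
    cycSum A i u v w = (scaled A i u v * scaled A i v w + scaled A i v w * scaled A i w u +
      scaled A i w u * scaled A i u v + scaled A i v u * scaled A i w v +
      scaled A i w v * scaled A i u w + scaled A i u w * scaled A i v u) *
      (A i u * A u i * (A i v * A v i) * (A i w * A w i)) := by
  have := hA _ _ h1.symm
  have := hA _ _ h2.symm
  have := hA _ _ h3.symm
  have := hA _ _ h1
  have := hA _ _ h2
  have := hA _ _ h3
  unfold cycSum scaled
  field_simp
  ring

lemma mul_eq_mul_of_scaled_left (hA : IsDense A) {i u v w : ι} (h1 : u ≠ i) (h2 : i ≠ w)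
    (h3 : i ≠ v) (h : scaled A i u v = scaled A i u w) : A i w * A u v = A i v * A u w := by
  have := hA _ _ h1
  have := hA _ _ h2
  have := hA _ _ h3
  unfold scaled at h
  field_simp at h
  linear_combination h

lemma mul_eq_mul_of_scaled_right (hA : IsDense A) {i u v w : ι} (h1 : i ≠ u) (h2 : i ≠ w)
    (h3 : i ≠ v) (h : scaled A i v u = scaled A i w u) : A w i * A v u = A w u * A v i := by
  have := hA _ _ h1
  have := hA _ _ h2.symm
  have := hA _ _ h3.symm
  unfold scaled at h
  field_simp at h
  linear_combination h

lemma CycEq.dense (h : CycEq A B) (hA : IsDense A) : IsDense B := fun i j hij h0 => by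
  have := h.pair i j hij
  rw [h0, zero_mul] at this
  exact mul_ne_zero (hA i j hij) (hA j i hij.symm) this

variable [DecidableEq ι]

/-- On the triple `i, j, k`, the matrix `A` is not symmetric up to scaling, and `B` agrees with `A`
up to scaling. -/
def SameTriple (hA : IsDense A) (B : Matrix ι ι F) (i j k : ι) : Prop :=
  skew (logEntry hA) i j k ≠ 0 ∧ cyc B i j k = cyc A i j k ∧ cyc B j i k = cyc A j i k

/-- On the triple `i, j, k`, the matrix `A` is not symmetric up to scaling, and `B` agrees with the
transpose of `A` up to scaling. -/
def OppositeTriple (hA : IsDense A) (B : Matrix ι ι F) (i j k : ι) : Prop :=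
  skew (logEntry hA) i j k ≠ 0 ∧ cyc B i j k = cyc A j i k ∧ cyc B j i k = cyc A i j k

/-- Scaling row and column `i` to `1` turns cyclic products through `i` into single entries, up to
pair products common to `A` and `B`. The quadruple sum and the triple `j, k, l` then feed
`flip_cases`, whose two outcomes are the two splits. -/
lemma CycEq.rule (h : CycEq A B) (hA : IsDense A) {i j k l : ι} (hS : SameTriple hA B i j k)
    (hO : OppositeTriple hA B i j l) :
    (SameTriple hA B i k l ∧ OppositeTriple hA B j k l ∧ Split (logEntry hA) i k j l) ∨
      (SameTriple hA B j k l ∧ OppositeTriple hA B i k l ∧ Split (logEntry hA) j k i l) := by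
  obtain ⟨hS0, hS1, hS2⟩ := hS
  obtain ⟨hO0, hO1, hO2⟩ := hO
  obtain ⟨ij, ik, jk⟩ := ne_of_skew_ne_zero hS0
  obtain ⟨-, il, jl⟩ := ne_of_skew_ne_zero hO0
  have skij := (skew_logEntry hA ij ik jk).not.1 hS0
  have skil := (skew_logEntry hA ij il jl).not.1 hO0
  have kl : k ≠ l := by
    rintro rfl
    exact skij (hS1.symm.trans hO1)
  have hB := h.dense hA
  have np : ∀ u, i ≠ u → A i u * A u i ≠ 0 := fun u hu => mul_ne_zero (hA _ _ hu) (hA _ _ hu.symm)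
  have nc : ∀ u v, i ≠ u → i ≠ v → A i u * A u i * (A i v * A v i) ≠ 0 := fun u v hu hv =>
    mul_ne_zero (np u hu) (np v hv)
  have hB1 : ∀ u v, i ≠ u → i ≠ v →
      cyc B i u v = scaled B i u v * (A i u * A u i * (A i v * A v i)) := fun u v hu hv => by
    rw [cyc_eq_scaled hB hu hv, h.pair i u hu, h.pair i v hv]
  have hB2 : ∀ u v, i ≠ u → i ≠ v →
      cyc B u i v = scaled B i v u * (A i u * A u i * (A i v * A v i)) := fun u v hu hv => by
    rw [cyc_eq_scaled_swap hB hu hv, h.pair i u hu, h.pair i v hv]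
  have hq := h.quad i j k l ij ik il jk jl kl
  have ht := h.triple j k l jk jl kl
  have hY := h.cyc_eq ik il kl
  rw [hB1 j k ij ik, cyc_eq_scaled hA ij ik, mul_left_inj' (nc j k ij ik)] at hS1
  rw [hB2 j k ij ik, cyc_eq_scaled_swap hA ij ik, mul_left_inj' (nc j k ij ik)] at hS2
  rw [cyc_eq_scaled hA ij ik, cyc_eq_scaled_swap hA ij ik, mul_left_inj' (nc j k ij ik)] at skij
  rw [hB1 j l ij il, cyc_eq_scaled_swap hA ij il, mul_left_inj' (nc j l ij il)] at hO1
  rw [hB2 j l ij il, cyc_eq_scaled hA ij il, mul_left_inj' (nc j l ij il)] at hO2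
  rw [cyc_eq_scaled hA ij il, cyc_eq_scaled_swap hA ij il, mul_left_inj' (nc j l ij il)] at skil
  rw [hB1 k l ik il, hB2 k l ik il, cyc_eq_scaled hA ik il, cyc_eq_scaled_swap hA ik il,
    mul_left_inj' (nc k l ik il), mul_left_inj' (nc k l ik il), mul_left_inj' (nc k l ik il),
    mul_left_inj' (nc k l ik il)] at hY
  have njkl := mul_ne_zero (nc j k ij ik) (np l il)
  rw [cycSum_eq_scaled hA ij ik il, cycSum_eq_scaled hB ij ik il, ← h.pair i j ij,
    ← h.pair i k ik, ← h.pair i l il, mul_left_inj' njkl, hS1, hS2, hO1, hO2] at hq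
  have cA : cyc A k j l = scaled A i k j * scaled A i j l * scaled A i l k *
      (A i j * A j i * (A i k * A k i) * (A i l * A l i)) := by
    rw [cyc_eq_scaled' hA ik ij il]; ring
  have cB : cyc B k j l = scaled B i k j * scaled B i j l * scaled B i l k *
      (A i j * A j i * (A i k * A k i) * (A i l * A l i)) := by
    rw [cyc_eq_scaled' hB ik ij il, h.pair i j ij, h.pair i k ik, h.pair i l il]; ring
  have cA' := cyc_eq_scaled' hA ij ik il
  have cB' := cyc_eq_scaled' hB ij ik il
  rw [← h.pair i j ij, ← h.pair i k ik, ← h.pair i l il] at cB'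
  have ht' := ht
  rw [cA, cA', cB, cB', ← add_mul, ← add_mul, mul_left_inj' njkl, hS1, hS2, hO1, hO2] at ht'
  have sz : ∀ u v, i ≠ u → i ≠ v → u ≠ v → scaled A i u v ≠ 0 := fun u v h1 h2 h3 =>
    div_ne_zero (hA _ _ h3) (mul_ne_zero (hA _ _ h1.symm) (hA _ _ h2))
  rcases flip_cases skij (Ne.symm skil) hY (by linear_combination -hq)
    (by linear_combination -ht') with ⟨y1, y2, y3, y4⟩ | ⟨y1, y2, y3, y4⟩
  · refine .inl ⟨⟨?_, ?_, ?_⟩, ⟨?_, ?_, ?_⟩, ?_, ?_⟩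
    · rw [Ne, skew_logEntry hA ik il kl, cyc_eq_scaled hA ik il, cyc_eq_scaled_swap hA ik il,
        mul_left_inj' (nc k l ik il), y3, y4]
      exact Ne.symm skij
    · rw [hB1 k l ik il, cyc_eq_scaled hA ik il, y1]
    · rw [hB2 k l ik il, cyc_eq_scaled_swap hA ik il, y2]
    · rw [Ne, skew_logEntry hA jk jl kl, cA', cA, mul_left_inj' njkl, y3, y4]
      intro h0
      exact skil (mul_left_cancel₀ (mul_ne_zero (sz j k ij ik jk) (sz k j ik ij jk.symm))
        (by linear_combination -h0))
    · rw [cB', cA, hS1, hO2, y1, y3, y4]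
      ring
    · rw [cB, cA', hS2, hO1, y2, y3, y4]
      ring
    · rw [cross_logEntry hA ij il jk.symm kl]
      exact mul_eq_mul_of_scaled_left hA ik.symm ij il y3
    · rw [cross_logEntry hA ij.symm jk il.symm kl.symm]
      exact mul_eq_mul_of_scaled_right hA ik ij il y4
  · refine .inr ⟨⟨?_, ?_, ?_⟩, ⟨?_, ?_, ?_⟩, ?_, ?_⟩
    · rw [Ne, skew_logEntry hA jk jl kl, cA', cA, mul_left_inj' njkl, y3, y4]
      intro h0
      exact skij (mul_left_cancel₀ (mul_ne_zero (sz j l ij il jl) (sz l j il ij jl.symm))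
        (by linear_combination h0))
    · rw [cB', cA', hS1, hO2, y1, y3, y4]
      ring
    · rw [cB, cA, hS2, hO1, y2, y3, y4]
      ring
    · rw [Ne, skew_logEntry hA ik il kl, cyc_eq_scaled hA ik il, cyc_eq_scaled_swap hA ik il,
        mul_left_inj' (nc k l ik il), y3, y4]
      exact skil
    · rw [hB1 k l ik il, cyc_eq_scaled_swap hA ik il, y1]
    · rw [hB2 k l ik il, cyc_eq_scaled hA ik il, y2]
    · rw [cross_logEntry hA ij.symm jl ik.symm kl]
      exact mul_eq_mul_of_scaled_right hA il ij ik y3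
    · rw [cross_logEntry hA ij ik jl.symm kl.symm]
      exact mul_eq_mul_of_scaled_left hA il.symm ij ik y4

lemma CycEq.coloring (h : CycEq A B) (hA : IsDense A) :
    Coloring (logEntry hA) (SameTriple hA B) (OppositeTriple hA B) where
  rotS i j k := by
    unfold SameTriple
    rw [skew_rot i j k, cyc_rot B i j k, cyc_rot A i j k, cyc_rot B i k j, cyc_rot B j i k,
      cyc_rot A i k j, cyc_rot A j i k]
  swapS i j k := by
    unfold SameTriple
    rw [skew_swap, neg_ne_zero, and_comm (a := cyc B i j k = _)]
  rotO i j k := by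
    unfold OppositeTriple
    rw [skew_rot i j k, cyc_rot B i j k, cyc_rot A i j k, cyc_rot B i k j, cyc_rot B j i k,
      cyc_rot A i k j, cyc_rot A j i k]
  swapO i j k := by
    unfold OppositeTriple
    rw [skew_swap, neg_ne_zero, and_comm (a := cyc B i j k = _)]
  neS i j k h := h.1
  neO i j k h := h.1
  total i j k h0 := by
    obtain ⟨h1, h2, h3⟩ := ne_of_skew_ne_zero h0
    exact (h.cyc_eq h1 h2 h3).imp (⟨h0, ·⟩) (⟨h0, ·⟩)
  disj i j k hS hO := by
    obtain ⟨h1, h2, h3⟩ := ne_of_skew_ne_zero hS.1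
    exact hS.1 ((skew_logEntry hA h1 h2 h3).2 (hS.2.1.symm.trans hO.2.1))
  rule i j k l hS hO := h.rule hA hS hO

/-! ### Diagonal similarity. -/

/-- Dense matrices with equal diagonals and equal cyclic products of length two and three are
diagonally similar. -/
lemma PME.of_cyc_eq (hA : IsDense A) (hd : ∀ i, A i i = B i i)
    (hp : ∀ i j, i ≠ j → A i j * A j i = B i j * B j i)
    (hc : ∀ i j k, i ≠ j → i ≠ k → j ≠ k → cyc B i j k = cyc A i j k) : PME A B := by
  intro S
  rcases isEmpty_or_nonempty ι with hι | ⟨⟨o⟩⟩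
  · congr 1
    ext i
    exact isEmptyElim (i : ι)
  have hB : ∀ i j, i ≠ j → B i j ≠ 0 := fun i j hij h0 => by
    have := hp i j hij
    rw [h0, zero_mul] at this
    exact mul_ne_zero (hA i j hij) (hA j i hij.symm) this
  -- Row `o` of the similarity forces these values; the remaining entries follow from cyclic
  -- products through `o`.
  let d : ι → F := fun j => if o = j then 1 else B o j / A o j
  have d0 : ∀ j, d j ≠ 0 := by
    intro j
    by_cases hj : o = j
    · simp [d, hj]
    · simpa [d, hj] using ⟨hB o j hj, hA o j hj⟩
  have key : ∀ i j, B i j * d i = A i j * d j := by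
    intro i j
    by_cases hij : i = j
    · rw [hij, hd]
    by_cases hi : o = i
    · subst hi
      have := hA o j hij
      simp only [d, if_true, if_neg hij]
      field_simp
    by_cases hj : o = j
    · subst hj
      have := hA o i hi
      simp only [d, if_true, if_neg hi]
      field_simp
      linear_combination -hp o i hi
    · have h1 := hA o i hi
      have h2 := hA o j hj
      have h3 := hc o i j hi hj hij
      have h4 := hp o j hj
      simp only [d, if_neg hi, if_neg hj]
      unfold cyc at h3
      field_simp
      refine mul_right_cancel₀ (hB j o (Ne.symm hj)) ?_
      linear_combination A o j * h3 + A o i * A i j * h4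
  have hm : Matrix.diagonal (fun i : S => d i) * sub B S S =
      sub A S S * Matrix.diagonal (fun i : S => d i) := by
    ext i j
    rw [Matrix.diagonal_mul, Matrix.mul_diagonal, mul_comm]
    exact key i j
  have hdet := congrArg Matrix.det hm
  rw [Matrix.det_mul, Matrix.det_mul, Matrix.det_diagonal, mul_comm] at hdet
  exact (mul_right_cancel₀ (Finset.prod_ne_zero_iff.2 fun (i : S) _ => d0 i) hdet).symm

/-! ### Contradiction with the absence of cuts, and conclusion. -/

variable [Fintype ι]

lemma Dich.isCut (hA : IsDense A) (hR : RankOneExtension A) {S O : ι → ι → ι → Prop}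
    (H : Coloring (logEntry hA) S O) {i j k l : ι} (h : Dich (logEntry hA) S O i j k l) :
    ∃ X, IsCut A X := by
  classical
  obtain ⟨X, hi, hj, hk, hl, hX⟩ := h.exists_cut H (hR.extends hA)
  obtain ⟨n1, n2, n3⟩ := H.ne h.s₁
  obtain ⟨n4, n5, n6⟩ := H.dual.ne h.o₁
  let Y : Finset ι := Finset.univ.filter (· ∈ X)
  have hY : ∀ x, x ∈ Y ↔ x ∈ X := fun x => by simp [Y]
  have hY' : ∀ x, x ∈ Yᶜ ↔ x ∉ X := fun x => by rw [Finset.mem_compl, hY]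
  have ne : ∀ x ∈ X, ∀ y ∉ X, x ≠ y := by
    rintro x hx y hy rfl
    exact hy hx
  have c1 : 2 ≤ Y.card := Finset.one_lt_card.2 ⟨i, (hY i).2 hi, j, (hY j).2 hj, n1⟩
  have c2 : 2 ≤ Yᶜ.card := Finset.one_lt_card.2 ⟨k, (hY' k).2 hk, l, (hY' l).2 hl, n6⟩
  refine ⟨Y, c1, ?_, ?_, ?_⟩
  · rw [Finset.card_compl] at c2
    omega
  · refine rank_le_one_of_mul_eq_mul ⟨i, (hY i).2 hi⟩ ⟨k, (hY' k).2 hk⟩ (hA i k n2) ?_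
    rintro ⟨x, hx⟩ ⟨y, hy⟩
    rw [hY] at hx
    rw [hY'] at hy
    have := (cross_logEntry hA n2 (ne i hi y hy) (ne x hx k hk) (ne x hx y hy)).1 (hX x hx y hy).1
    simp only [sub, Matrix.submatrix_apply]
    linear_combination this
  · refine rank_le_one_of_mul_eq_mul ⟨k, (hY' k).2 hk⟩ ⟨i, (hY i).2 hi⟩ (hA k i n2.symm) ?_
    rintro ⟨y, hy⟩ ⟨x, hx⟩
    rw [hY] at hx
    rw [hY'] at hy
    have := (cross_logEntry hA n2.symm (ne x hx k hk).symm (ne i hi y hy).symm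
      (ne x hx y hy).symm).1 (hX x hx y hy).2
    simp only [sub, Matrix.submatrix_apply]
    linear_combination this

/-- Without cuts, principal minors of order at most four determine all principal minors. -/
lemma PMEUpTo.pme (hR : PropertyR A) (hcut : ¬ ∃ X, IsCut A X) (h : PMEUpTo 4 A B) : PME A B := by
  obtain ⟨hA, hR⟩ := hR
  have hc := h.cycEq
  have H := hc.coloring hA
  by_cases hO : ∃ i j k, OppositeTriple hA B i j k
  · obtain ⟨u, v, w, hO⟩ := hO
    have hS : ∀ i j k, ¬ SameTriple hA B i j k := by
      intro i j k hS
      obtain ⟨i, j, k, l, h1, h2⟩ := H.exists_adjacent hS hO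
      rcases hc.rule hA h1 h2 with ⟨h3, h4, h5⟩ | ⟨h3, h4, h5⟩
      · exact hcut (Dich.isCut hA hR H ⟨(H.permS h1).1, h3, h2, (H.permO h4).2.1, h5⟩)
      · exact hcut (Dich.isCut hA hR H ⟨(H.permS h1).2.2.1, h3, (H.permO h2).2.1,
          (H.permO h4).2.1, h5⟩)
    -- Only opposite triples remain, apart from those whose two cyclic products coincide, where the
    -- orientation is immaterial.
    have : PME Aᵀ B := by
      refine PME.of_cyc_eq (fun i j hij => hA j i hij.symm) hc.diag
        (fun i j hij => ?_) fun i j k h1 h2 h3 => ?_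
      · rw [← hc.pair i j hij]
        exact mul_comm _ _
      · have e : cyc Aᵀ i j k = cyc A j i k := by
          simp only [cyc, Matrix.transpose_apply]
          ring
        rw [e]
        rcases hc.cyc_eq h1 h2 h3 with h4 | h4
        · by_contra h5
          exact hS i j k ⟨fun h0 => h5 (h4.1.trans ((skew_logEntry hA h1 h2 h3).1 h0)), h4⟩
        · exact h4.1
    intro S
    rw [← this S, ← Matrix.det_transpose]
    rfl
  · push Not at hO
    refine PME.of_cyc_eq hA hc.diag hc.pair fun i j k h1 h2 h3 => ?_
    rcases hc.cyc_eq h1 h2 h3 with h4 | h4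
    · exact h4.1
    · by_contra h5
      exact hO i j k ⟨fun h0 => h5 (h4.1.trans ((skew_logEntry hA h1 h2 h3).1 h0).symm), h4⟩

end MatrixColoring

end PrincipalMinors

theorem theorem4p10 {F : Type*} [Field F] (n : ℕ) (A B : Matrix (Fin n) (Fin n) F)
    (hR : PrincipalMinors.PropertyR A)
    (hcut : ¬ ∃ X : Finset (Fin n), PrincipalMinors.IsCut A X) :
    PrincipalMinors.PME A B ↔ PrincipalMinors.PMEUpTo 4 A B :=
  ⟨fun h S _ => h S, fun h => h.pme hR hcut⟩
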